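/- Let $n\ge 3$ and let $X_1,\dots,X_n$ be independent random variables with common distribution $F$ on $(0,\infty)$, where $F$ has a density $f$ that is continuous and strictly positive on $(0,\infty)$. Let $X_{(1)}\le\cdots\le X_{(n)}$ be the order statistics and $\overline X_n=\frac1n\sum_{i=1}^n X_i$ the sample mean. Put $$\mathbf A=\Big\{\lambda=(\lambda_1,\dots,\lambda_n)\in\mathbb R^n:\ \lambda_1\le\lambda_2\le\cdots\le\lambda_n,\ \sum_{i=1}^n\lambda_i=0\Big\},$$ and let $U:\mathbf A\to\mathbb R$ be a feasible definite function of homogeneity degree $1$, that is: (i) $U$ is nonnegative and continuous on $\mathbf A$; (ii) for $\lambda\in\mathbf A$, $U(\lambda)=0$ if and only if $\lambda=(0,\dots,0)$; (iii) $U(s\lambda)=s\,U(\lambda)$ for all $s>0$ and all $\lambda\in\mathbf A$. Define $Z_n=U(X_{(1)}-\overline X_n,\dots,X_{(n)}-\overline X_n)$ and $V_n=Z_n/\overline X_n$. Then $\overline X_n$ and $V_n$ are independent if and only if $F$ is a gamma distribution, that is, if and only if there are $a>0$ and $b>0$ such that $F$ has the density $\frac{1}{\Gamma(a)\,b^a}\,x^{a-1}e^{-x/b}$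 for $x>0$ (and $0$ for $x\le 0$). -/

import Mathlib

open MeasureTheory ProbabilityTheory

/-- The ordered zero-sum cone
`A = {(l₁, …, lₙ) : l₁ ≤ l₂ ≤ ⋯ ≤ lₙ, l₁ + ⋯ + lₙ = 0}` in `ℝⁿ`. -/
def orderedZeroSumCone (n : ℕ) : Set (Fin n → ℝ) :=
  {l | Monotone l ∧ ∑ i, l i = 0}

/-- `U` (of which only the values on the cone `A` matter) is a feasible definite function of
positive degree `p` of homogeneity: nonnegative and continuous on `A`, vanishing on `A` exactly at
the origin, and positively homogeneous of degree `p` on `A`. -/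
structure IsFeasibleDefinite {n : ℕ} (U : (Fin n → ℝ) → ℝ) (p : ℝ) : Prop where
  degree_pos : 0 < p
  nonneg : ∀ l ∈ orderedZeroSumCone n, 0 ≤ U l
  continuousOn : ContinuousOn U (orderedZeroSumCone n)
  eq_zero_iff : ∀ l ∈ orderedZeroSumCone n, (U l = 0 ↔ l = 0)
  homogeneous : ∀ s : ℝ, 0 < s → ∀ l ∈ orderedZeroSumCone n, U (s • l) = s ^ p * U l

/-- The order statistics `x₍₁₎ ≤ ⋯ ≤ x₍ₙ₎`: the values of `x` rearranged in increasing order. -/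
noncomputable def orderStat {n : ℕ} (x : Fin n → ℝ) (i : Fin n) : ℝ :=
  x (Tuple.sort x i)

/-- The sample mean `(x₁ + ⋯ + xₙ) / n`. -/
noncomputable def sampleMean {n : ℕ} (x : Fin n → ℝ) : ℝ :=
  (∑ i, x i) / n

/-- The statistic `U(x₍₁₎ - x̄, …, x₍ₙ₎ - x̄)`. -/
noncomputable def feasibleStat {n : ℕ} (U : (Fin n → ℝ) → ℝ) (x : Fin n → ℝ) : ℝ :=
  U (fun i => orderStat x i - sampleMean x)

/-- `F` is a gamma distribution: for some shape `a > 0` and scale `b > 0` (that is, rate `b⁻¹`)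
it has the density `x ^ (a - 1) * exp (-x / b) / (Γ(a) * b ^ a)` on `(0, ∞)`. -/
def IsGammaDistribution (F : Measure ℝ) : Prop :=
  ∃ a b : ℝ, 0 < a ∧ 0 < b ∧ F = gammaMeasure a b⁻¹

/-!
For a sample `x` in `(0, ∞)ⁿ` write `x = s (1 + y)` with `s` the sample mean and `y` in the
hyperplane of zero-sum vectors. By translation invariance and homogeneity of the statistic, the
quotient of the statistic by the mean is a function `W y` of `y` alone. In these coordinates the
joint density is `s ^ (n - 1) * ∏ f (s (1 + yᵢ))` (`exists_haar_pi_apply`).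

If `f` is a gamma density, the joint density is a function of `s` times a function of `y`, because
`∑ s (1 + yᵢ) = n s`; this gives independence (`indepFun_pi_gammaMeasure`).

For the converse let `J ε s = ∫ ∏ f (s (1 + yᵢ)) dy` over the cap `W y ≤ ε`. Independence makes the
functions `J ε` for different `ε` proportional to each other, almost everywhere and hence everywhere
by continuity. As `ε → 0` the average over the cap tends to `f s ^ n`, so `J ε s = k ε * f s ^ n`
with `k ε` not depending on `s` (`eventually_capIntegral_mul_eq`).

No differentiability of `f` is available, so this equation is used through a comparison argument in
the style of viscosity solutions. If `log f + c log` minus an affine function has an interior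
maximum at `x₀`, then, since the affine part cancels over zero-sum vectors,
`J ε x₀ ≤ f x₀ ^ n * ∫ ∏ (1 + yᵢ) ^ (-c) dy`; an interior minimum gives the reverse inequality. The
integral on the right is strictly increasing in `c`, because `∑ log (1 + yᵢ) < 0` for zero-sum
`y ≠ 0`. So an interior maximum for `c` excludes an interior minimum for any `c' > c`
(`not_secondDiff_neg_and_pos`). Choosing `c` to annihilate one second difference of `log f + c log`
therefore annihilates all of them (`exists_log_eq`). Thus `log f + c log` is affine, and
integrability of `f` makes it a gamma density (`isGammaDistribution_of_log_eq`).
-/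

open scoped ENNReal Topology
open Filter

/-! ### The statistic as a function on `ℝⁿ` -/

lemma orderStat_eq_of_monotone {n : ℕ} {x : Fin n → ℝ} {σ : Equiv.Perm (Fin n)}
    (h : Monotone (x ∘ σ)) : orderStat x = x ∘ σ :=
  (Tuple.comp_sort_eq_comp_iff_monotone.mpr h).symm

lemma orderStat_comp_of_monotone {n : ℕ} {g : ℝ → ℝ} (hg : Monotone g) (x : Fin n → ℝ) :
    orderStat (fun i => g (x i)) = fun i => g (orderStat x i) :=
  orderStat_eq_of_monotone (σ := Tuple.sort x) (hg.comp (Tuple.monotone_sort x))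

lemma sampleMean_smul {n : ℕ} (s : ℝ) (x : Fin n → ℝ) :
    sampleMean (fun i => s * x i) = s * sampleMean x := by
  simp only [sampleMean, ← Finset.mul_sum, mul_div_assoc]

lemma sampleMean_const_add {n : ℕ} (hn : n ≠ 0) (t : ℝ) (x : Fin n → ℝ) :
    sampleMean (fun i => t + x i) = t + sampleMean x := by
  have : (n : ℝ) ≠ 0 := Nat.cast_ne_zero.mpr hn
  simp [sampleMean, Finset.sum_add_distrib]
  field_simp

lemma continuous_sampleMean {n : ℕ} : Continuous (sampleMean : (Fin n → ℝ) → ℝ) := by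
  unfold sampleMean
  fun_prop

lemma comp_perm_sub_sampleMean_mem_cone {n : ℕ} (hn : n ≠ 0) {x : Fin n → ℝ}
    {σ : Equiv.Perm (Fin n)} (h : Monotone (x ∘ σ)) :
    (fun i => x (σ i) - sampleMean x) ∈ orderedZeroSumCone n := by
  refine ⟨fun i j hij => sub_le_sub_right (h hij) _, ?_⟩
  have : (n : ℝ) ≠ 0 := Nat.cast_ne_zero.mpr hn
  rw [Finset.sum_sub_distrib, Equiv.sum_comp σ x]
  simp [sampleMean]
  field_simp
  ring

lemma orderStat_sub_sampleMean_mem_cone {n : ℕ} (hn : n ≠ 0) (x : Fin n → ℝ) :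
    (fun i => orderStat x i - sampleMean x) ∈ orderedZeroSumCone n :=
  comp_perm_sub_sampleMean_mem_cone hn (Tuple.monotone_sort x)

/-- Sorting is continuous: on each of the finitely many closed sets where a given permutation sorts
the vector, it is that permutation of the coordinates. -/
lemma continuous_feasibleStat {n : ℕ} (hn : n ≠ 0) {U : (Fin n → ℝ) → ℝ} {p : ℝ}
    (hU : IsFeasibleDefinite U p) : Continuous (feasibleStat U) := by
  let M : Equiv.Perm (Fin n) → Set (Fin n → ℝ) := fun σ => {x | Monotone (x ∘ σ)}
  refine (locallyFinite_of_finite M).continuous ?_ (fun σ => ?_) (fun σ => ?_)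
  · exact Set.eq_univ_of_forall fun x => Set.mem_iUnion.mpr ⟨Tuple.sort x, Tuple.monotone_sort x⟩
  · have : M σ = ⋂ i, ⋂ j, ⋂ _ : i ≤ j, {x : Fin n → ℝ | x (σ i) ≤ x (σ j)} := by
      ext x
      simp [M, Monotone]
    rw [this]
    exact isClosed_iInter fun i => isClosed_iInter fun j => isClosed_iInter fun _ =>
      isClosed_le (by fun_prop) (by fun_prop)
  · have hcont : Continuous fun (x : Fin n → ℝ) (i : Fin n) => x (σ i) - sampleMean x :=
      continuous_pi fun i => (continuous_apply _).sub continuous_sampleMean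
    refine (hU.continuousOn.comp (t := orderedZeroSumCone n) hcont.continuousOn
      (s := M σ) fun x hx => comp_perm_sub_sampleMean_mem_cone hn hx).congr fun x hx => ?_
    simp only [feasibleStat, orderStat_eq_of_monotone hx, Function.comp_apply]

lemma feasibleStat_nonneg {n : ℕ} (hn : n ≠ 0) {U : (Fin n → ℝ) → ℝ} {p : ℝ}
    (hU : IsFeasibleDefinite U p) (x : Fin n → ℝ) : 0 ≤ feasibleStat U x :=
  hU.nonneg _ (orderStat_sub_sampleMean_mem_cone hn x)

lemma feasibleStat_const_add {n : ℕ} (hn : n ≠ 0) (U : (Fin n → ℝ) → ℝ) (t : ℝ)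
    (x : Fin n → ℝ) : feasibleStat U (fun i => t + x i) = feasibleStat U x := by
  have h := orderStat_comp_of_monotone (g := fun u => t + u) (fun a b h => by simpa using h) x
  simp only [feasibleStat, h, sampleMean_const_add hn, add_sub_add_left_eq_sub]

lemma feasibleStat_smul {n : ℕ} (hn : n ≠ 0) {U : (Fin n → ℝ) → ℝ}
    (hU : IsFeasibleDefinite U 1) {s : ℝ} (hs : 0 < s) (x : Fin n → ℝ) :
    feasibleStat U (fun i => s * x i) = s * feasibleStat U x := by
  have h := orderStat_comp_of_monotone (g := fun u => s * u)
    (fun a b h => by simpa [hs] using h) x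
  have h2 := hU.homogeneous s hs _ (orderStat_sub_sampleMean_mem_cone hn x)
  rw [Real.rpow_one] at h2
  rw [feasibleStat, feasibleStat, ← h2, h, sampleMean_smul]
  congr 1
  ext i
  simp [mul_sub]

lemma eq_zero_of_feasibleStat_eq_zero {n : ℕ} (hn : n ≠ 0) {U : (Fin n → ℝ) → ℝ} {p : ℝ}
    (hU : IsFeasibleDefinite U p) {x : Fin n → ℝ} (hx : ∑ i, x i = 0)
    (h : feasibleStat U x = 0) : x = 0 := by
  have h0 := (hU.eq_zero_iff _ (orderStat_sub_sampleMean_mem_cone hn x)).mp h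
  ext i
  have := congrFun h0 ((Tuple.sort x).symm i)
  simpa [orderStat, sampleMean, hx] using this

/-! ### Mean and deviations as coordinates -/

/-- The hyperplane of vectors with coordinate sum zero. A positive vector `x` with mean `s` is
written `s (1 + y)` with `y` in this hyperplane. -/
def zeroSum (n : ℕ) : Submodule ℝ (Fin n → ℝ) where
  carrier := {y | ∑ i, y i = 0}
  add_mem' {a b} ha hb := by
    simp only [Set.mem_ofPred_eq, Pi.add_apply, Finset.sum_add_distrib] at *
    rw [ha, hb, add_zero]
  zero_mem' := by simp
  smul_mem' c x hx := by
    simp only [Set.mem_ofPred_eq, Pi.smul_apply, smul_eq_mul, ← Finset.mul_sum] at *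
    rw [hx, mul_zero]

lemma sum_zeroSum {n : ℕ} (y : zeroSum n) : ∑ i, (y : Fin n → ℝ) i = 0 := y.2

lemma sampleMean_zeroSum {n : ℕ} (y : zeroSum n) : sampleMean (y : Fin n → ℝ) = 0 := by
  simp [sampleMean, sum_zeroSum y]

/-- The splitting of a vector into its mean and its deviations from the mean. -/
noncomputable def meanAddDeviation {n : ℕ} (hn : n ≠ 0) :
    (ℝ × zeroSum n) ≃ₗ[ℝ] (Fin n → ℝ) where
  toFun p i := p.1 + (p.2 : Fin n → ℝ) i
  map_add' p q := by
    ext i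
    simp only [Prod.fst_add, Prod.snd_add, Submodule.coe_add, Pi.add_apply]
    ring
  map_smul' c p := by
    ext i
    simp [mul_add]
  invFun x := (sampleMean x, ⟨fun i => x i - sampleMean x, by
    have : (n : ℝ) ≠ 0 := Nat.cast_ne_zero.mpr hn
    change ∑ i, (x i - sampleMean x) = 0
    rw [Finset.sum_sub_distrib]
    simp [sampleMean]
    field_simp
    ring⟩)
  left_inv p := by
    have h : sampleMean (fun i => p.1 + (p.2 : Fin n → ℝ) i) = p.1 := by
      rw [sampleMean_const_add hn, sampleMean_zeroSum, add_zero]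
    refine Prod.ext h (Subtype.ext (funext fun i => ?_))
    simp [h]
  right_inv x := by
    ext i
    simp

lemma finrank_zeroSum {n : ℕ} (hn : n ≠ 0) : Module.finrank ℝ (zeroSum n) = n - 1 := by
  have h := (meanAddDeviation hn).finrank_eq
  rw [Module.finrank_prod, Module.finrank_self, Module.finrank_fin_fun] at h
  omega

/-- Lebesgue integration in the coordinates `x = s (1 + y)`, with `s` the mean and `y` in the
hyperplane `zeroSum n`. The constant Jacobian is absorbed into the Haar measure of the hyperplane.
-/
lemma exists_haar_lintegral_eq {n : ℕ} (hn : n ≠ 0) :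
    ∃ q : Measure (zeroSum n), q.IsAddHaarMeasure ∧
      ∀ G : (Fin n → ℝ) → ℝ≥0∞, Measurable G → (∀ x, sampleMean x ≤ 0 → G x = 0) →
        ∫⁻ x, G x = ∫⁻ s in Set.Ioi (0 : ℝ), ENNReal.ofReal (s ^ (n - 1)) *
          ∫⁻ y, G (fun i => s * (1 + (y : Fin n → ℝ) i)) ∂q := by
  let e := (meanAddDeviation hn).toContinuousLinearEquiv
  let q₀ : Measure (zeroSum n) := Measure.addHaar
  have hmap : (((volume : Measure ℝ).prod q₀).map e).IsAddHaarMeasure :=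
    e.isAddHaarMeasure_map _
  let c := Measure.addHaarScalarFactor (volume : Measure (Fin n → ℝ))
    (((volume : Measure ℝ).prod q₀).map e)
  have hc : (volume : Measure (Fin n → ℝ)) = c • ((volume : Measure ℝ).prod q₀).map e :=
    Measure.isAddLeftInvariant_eq_smul _ _
  have hc0 : (c : ℝ≥0∞) ≠ 0 := by
    have : 0 < c := Measure.addHaarScalarFactor_pos_of_isAddHaarMeasure _ _
    exact_mod_cast this.ne'
  refine ⟨(c : ℝ≥0∞) • q₀, Measure.IsAddHaarMeasure.smul q₀ hc0 ENNReal.coe_ne_top,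
    fun G hG hG0 => ?_⟩
  have he : ∀ s y, e (s, y) = fun i => s + (y : Fin n → ℝ) i := fun _ _ => rfl
  have hm : Measurable fun p : ℝ × zeroSum n => G (e p) := hG.comp e.continuous.measurable
  rw [hc, lintegral_smul_measure, lintegral_map hG e.continuous.measurable,
    lintegral_prod _ hm.aemeasurable]
  have hsupp : ∀ s : ℝ, s ≤ 0 → ∫⁻ y, G (e (s, y)) ∂q₀ = 0 := fun s hs => by
    refine (lintegral_congr fun y => hG0 _ ?_).trans lintegral_zero
    rw [he, sampleMean_const_add hn, sampleMean_zeroSum, add_zero]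
    exact hs
  rw [← setLIntegral_eq_of_support_subset (s := Set.Ioi 0)]
  · rw [ENNReal.smul_def, smul_eq_mul, ← lintegral_const_mul' _ _ ENNReal.coe_ne_top]
    refine setLIntegral_congr_fun measurableSet_Ioi fun s hs => ?_
    have hs : 0 < s := hs
    -- substituting `s • y` for `y` in the hyperplane, of dimension `n - 1`
    have hscale := Measure.map_addHaar_smul q₀ hs.ne'
    have hG2 : Measurable fun y : zeroSum n => G (e (s, y)) := hm.comp measurable_prodMk_left
    have h1 : ∫⁻ y, G (fun i => s * (1 + (y : Fin n → ℝ) i)) ∂q₀ =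
        ENNReal.ofReal (|(s ^ (n - 1))⁻¹|) * ∫⁻ y, G (e (s, y)) ∂q₀ := by
      rw [finrank_zeroSum hn] at hscale
      rw [← smul_eq_mul, ← lintegral_smul_measure, ← hscale,
        lintegral_map hG2 (measurable_const_smul s)]
      refine lintegral_congr fun y => ?_
      rw [he]
      congr 1
      ext i
      simp [mul_add]
    have hp : 0 < s ^ (n - 1) := pow_pos hs _
    simp only [lintegral_smul_measure, h1, smul_eq_mul]
    rw [abs_of_pos (inv_pos.mpr hp), mul_left_comm, ← mul_assoc (ENNReal.ofReal _)
      (ENNReal.ofReal _), ← ENNReal.ofReal_mul hp.le, mul_inv_cancel₀ hp.ne', ENNReal.ofReal_one,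
      one_mul]
  · intro s hs
    by_contra h
    exact hs (hsupp s (not_lt.mp h))

lemma pi_withDensity_ofReal {n : ℕ} {F : Measure ℝ} [IsFiniteMeasure F] {g : ℝ → ℝ}
    (hg : Measurable g) (hg0 : 0 ≤ g) (hF : F = volume.withDensity fun x => ENNReal.ofReal (g x)) :
    Measure.pi (fun _ : Fin n => F) =
      (volume : Measure (Fin n → ℝ)).withDensity fun x => ENNReal.ofReal (∏ i, g (x i)) := by
  have hint : Integrable g := by
    refine ⟨hg.aestronglyMeasurable, ?_⟩
    have h := measure_lt_top F Set.univ
    rw [hF, withDensity_apply _ MeasurableSet.univ, Measure.restrict_univ] at h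
    rwa [hasFiniteIntegral_iff_ofReal (Filter.Eventually.of_forall hg0)]
  refine (Measure.pi_eq fun s hs => ?_)
  rw [withDensity_apply _ (MeasurableSet.univ_pi hs), volume_pi, Measure.restrict_pi_pi,
    ← ofReal_integral_eq_lintegral_ofReal]
  · rw [integral_fintype_prod_eq_prod (fun _ => g),
      ENNReal.ofReal_prod_of_nonneg fun i _ => integral_nonneg hg0]
    refine Finset.prod_congr rfl fun i _ => ?_
    rw [hF, withDensity_apply _ (hs i), ofReal_integral_eq_lintegral_ofReal hint.integrableOn
      (Filter.Eventually.of_forall hg0)]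
  · exact Integrable.fintype_prod_dep fun i => hint.integrableOn
  · exact Filter.Eventually.of_forall fun x => Finset.prod_nonneg fun i _ => hg0 _

/-- The joint law of the mean and of the scale-invariant statistic, in the coordinates
`x = s (1 + y)`. -/
lemma exists_haar_pi_apply {n : ℕ} (hn : n ≠ 0) {U : (Fin n → ℝ) → ℝ}
    (hU : IsFeasibleDefinite U 1) :
    ∃ q : Measure (zeroSum n), q.IsAddHaarMeasure ∧
      ∀ (F : Measure ℝ) (g : ℝ → ℝ), IsProbabilityMeasure F → Measurable g → 0 ≤ g →
        (∀ x ≤ 0, g x = 0) → F = volume.withDensity (fun x => ENNReal.ofReal (g x)) →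
        ∀ C B : Set ℝ, MeasurableSet C → MeasurableSet B →
          Measure.pi (fun _ : Fin n => F)
              (sampleMean ⁻¹' C ∩ (fun x => feasibleStat U x / sampleMean x) ⁻¹' B) =
            ∫⁻ s in C, (ENNReal.ofReal (s ^ (n - 1)) *
              ∫⁻ y in {y : zeroSum n | feasibleStat U y ∈ B},
                ENNReal.ofReal (∏ i, g (s * (1 + (y : Fin n → ℝ) i))) ∂q)
              ∂(volume.restrict (Set.Ioi 0)) := by
  obtain ⟨q, hq, hint⟩ := exists_haar_lintegral_eq hn
  refine ⟨q, hq, fun F g hFp hg hg0 hgneg hF C B hC hB => ?_⟩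
  have hW := continuous_feasibleStat hn hU
  have hA : MeasurableSet
      (sampleMean ⁻¹' C ∩ (fun x : Fin n → ℝ => feasibleStat U x / sampleMean x) ⁻¹' B) :=
    (continuous_sampleMean.measurable hC).inter
      ((hW.measurable.div continuous_sampleMean.measurable) hB)
  have hBm : MeasurableSet {y : zeroSum n | feasibleStat U y ∈ B} :=
    (hW.comp continuous_subtype_val).measurable hB
  have hprod : Measurable fun x : Fin n → ℝ => ENNReal.ofReal (∏ i, g (x i)) :=
    (Finset.measurable_prod _ fun i _ => hg.comp (measurable_pi_apply i)).ennreal_ofReal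
  rw [pi_withDensity_ofReal hg hg0 hF, withDensity_apply _ hA, ← lintegral_indicator hA,
    hint _ (hprod.indicator hA), ← lintegral_indicator hC]
  · refine setLIntegral_congr_fun measurableSet_Ioi fun s hs => ?_
    have hs : 0 < s := hs
    have hmean : ∀ y : zeroSum n, sampleMean (fun i => s * (1 + (y : Fin n → ℝ) i)) = s :=
      fun y => by
        rw [sampleMean_smul, sampleMean_const_add hn, sampleMean_zeroSum, add_zero, mul_one]
    have hstat : ∀ y : zeroSum n,
        feasibleStat U (fun i => s * (1 + (y : Fin n → ℝ) i)) / s = feasibleStat U y := fun y => by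
      rw [feasibleStat_smul hn hU hs, feasibleStat_const_add hn, mul_div_cancel_left₀ _ hs.ne']
    by_cases hsC : s ∈ C
    · rw [Set.indicator_of_mem hsC]
      rw [← lintegral_indicator hBm]
      congr 1
      refine lintegral_congr fun y => ?_
      have hmem : (fun i => s * (1 + (y : Fin n → ℝ) i)) ∈ (sampleMean ⁻¹' C ∩
          (fun x : Fin n → ℝ => feasibleStat U x / sampleMean x) ⁻¹' B) ↔
          feasibleStat U y ∈ B := by
        change sampleMean _ ∈ C ∧ feasibleStat U _ / sampleMean _ ∈ B ↔ _
        rw [hmean, hstat]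
        exact and_iff_right hsC
      by_cases hy : feasibleStat U y ∈ B
      · rw [Set.indicator_of_mem (hmem.mpr hy), Set.indicator_of_mem (by exact hy)]
      · rw [Set.indicator_of_notMem fun h => hy (hmem.mp h), Set.indicator_of_notMem (by exact hy)]
    · rw [Set.indicator_of_notMem hsC]
      rw [lintegral_congr (g := fun _ => 0), lintegral_zero, mul_zero]
      intro y
      simp [Set.indicator, hmean, hsC]
  · intro x hx
    have : ∃ i, x i ≤ 0 := by
      by_contra! h
      have : Nonempty (Fin n) := Fin.pos_iff_nonempty.mp (Nat.pos_of_ne_zero hn)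
      have : 0 < sampleMean x := div_pos (Finset.sum_pos (fun i _ => h i) Finset.univ_nonempty)
        (Nat.cast_pos.mpr (Nat.pos_of_ne_zero hn))
      linarith
    obtain ⟨i, hi⟩ := this
    refine Set.indicator_apply_eq_zero.mpr fun _ => ?_
    rw [Finset.prod_eq_zero (Finset.mem_univ i) (hgneg _ hi), ENNReal.ofReal_zero]

/-! ### Gamma samples -/

/-- The independence of the mean and the scale-invariant statistic under a gamma sample: in the
coordinates `x = s (1 + y)` the joint density is a function of `s` times a function of `y`. -/
lemma indepFun_pi_gammaMeasure {n : ℕ} (hn : n ≠ 0) {U : (Fin n → ℝ) → ℝ}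
    (hU : IsFeasibleDefinite U 1) {a r : ℝ} (ha : 0 < a) (hr : 0 < r) :
    IndepFun sampleMean (fun x : Fin n → ℝ => feasibleStat U x / sampleMean x)
      (Measure.pi fun _ => gammaMeasure a r) := by
  obtain ⟨q, hq, hpi⟩ := exists_haar_pi_apply hn hU
  let k : ℝ → ℝ := fun u => if 0 < u then r ^ a / Real.Gamma a * u ^ (a - 1) else 0
  let g : ℝ → ℝ := fun u => k u * Real.exp (-(r * u))
  have hk0 : ∀ u, 0 ≤ k u := fun u => by
    simp only [k]
    have := Real.Gamma_pos_of_pos ha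
    split_ifs <;> positivity
  have hkm : Measurable k := Measurable.ite measurableSet_Ioi (by fun_prop) (by fun_prop)
  have hgm : Measurable g := by fun_prop
  have hg0 : 0 ≤ g := fun u => mul_nonneg (hk0 u) (Real.exp_pos _).le
  have hgneg : ∀ x ≤ 0, g x = 0 := fun x hx => by simp [g, k, not_lt.mpr hx]
  have hF : gammaMeasure a r = volume.withDensity fun x => ENNReal.ofReal (g x) := by
    refine withDensity_congr_ae ?_
    filter_upwards [compl_mem_ae_iff.mpr (measure_singleton (0 : ℝ))] with x hx
    have hx : x ≠ 0 := hx
    rw [gammaPDF, gammaPDFReal]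
    rcases lt_or_gt_of_ne hx with h | h
    · simp [g, k, not_lt.mpr h.le, not_le.mpr h]
    · simp [g, k, h, h.le]
  let α : ℝ → ℝ := fun s => s ^ (n - 1) * ((s ^ (a - 1)) ^ n * Real.exp (-(r * s * n)))
  have hfac : ∀ s, 0 < s → ∀ y : zeroSum n, ∏ i, g (s * (1 + (y : Fin n → ℝ) i)) =
      ((s ^ (a - 1)) ^ n * Real.exp (-(r * s * n))) * ∏ i, k (1 + (y : Fin n → ℝ) i) := by
    intro s hs y
    have h1 : ∀ u, k (s * u) = s ^ (a - 1) * k u := fun u => by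
      simp only [k, mul_pos_iff_of_pos_left hs]
      split_ifs with hu
      · rw [Real.mul_rpow hs.le hu.le]
        ring
      · simp
    simp only [g, h1, Finset.prod_mul_distrib, Finset.prod_const, Finset.card_univ,
      Fintype.card_fin, ← Real.exp_sum]
    have h2 : ∑ i, -(r * (s * (1 + (y : Fin n → ℝ) i))) = -(r * s * n) := by
      simp only [Finset.sum_neg_distrib, ← Finset.mul_sum, Finset.sum_add_distrib, sum_zeroSum y]
      simp
      ring
    rw [h2]
    ring
  have hprob : IsProbabilityMeasure (gammaMeasure a r) := isProbabilityMeasure_gammaMeasure ha hr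
  let A : Set ℝ → ℝ≥0∞ := fun C => ∫⁻ s in C, ENNReal.ofReal (α s) ∂(volume.restrict (Set.Ioi 0))
  let E : Set ℝ → ℝ≥0∞ := fun B => ∫⁻ y in {y : zeroSum n | feasibleStat U y ∈ B},
    ENNReal.ofReal (∏ i, k (1 + (y : Fin n → ℝ) i)) ∂q
  have hjoint : ∀ C B, MeasurableSet C → MeasurableSet B →
      Measure.pi (fun _ : Fin n => gammaMeasure a r)
        (sampleMean ⁻¹' C ∩ (fun x => feasibleStat U x / sampleMean x) ⁻¹' B) = A C * E B := by
    intro C B hC hB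
    rw [hpi _ g hprob hgm hg0 hgneg hF C B hC hB, ← lintegral_mul_const _ (by fun_prop)]
    refine lintegral_congr_ae (ae_restrict_of_ae ?_)
    filter_upwards [ae_restrict_mem measurableSet_Ioi] with s hs
    have hs : 0 < s := hs
    simp only [hfac s hs]
    rw [ENNReal.ofReal_mul (by positivity), mul_assoc (ENNReal.ofReal _)]
    congr 1
    simp only [E]
    rw [← lintegral_const_mul' _ _ ENNReal.ofReal_ne_top]
    refine lintegral_congr fun y => ?_
    rw [ENNReal.ofReal_mul (by positivity)]
  rw [indepFun_iff_measure_inter_preimage_eq_mul]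
  intro C B hC hB
  have h1 := hjoint Set.univ Set.univ MeasurableSet.univ MeasurableSet.univ
  have h2 := hjoint C Set.univ hC MeasurableSet.univ
  have h3 := hjoint Set.univ B MeasurableSet.univ hB
  simp only [Set.preimage_univ, Set.inter_univ, Set.univ_inter, measure_univ] at h1 h2 h3
  rw [hjoint C B hC hB, h2, h3]
  calc A C * E B = A C * E B * (A Set.univ * E Set.univ) := by rw [← h1, mul_one]
    _ = A C * E Set.univ * (A Set.univ * E B) := by ring

/-! ### Small caps in the hyperplane -/

/-- The part of the hyperplane where the statistic is at most `ε`: a compact neighbourhood of `0`,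
shrinking to `0` with `ε`. -/
def sublevel {n : ℕ} (U : (Fin n → ℝ) → ℝ) (ε : ℝ) : Set (zeroSum n) :=
  {y | feasibleStat U y ≤ ε}

lemma nontrivial_zeroSum {n : ℕ} (hn : 2 ≤ n) : Nontrivial (zeroSum n) :=
  Module.nontrivial_of_finrank_pos (R := ℝ) (by rw [finrank_zeroSum (by omega)]; omega)

lemma continuous_feasibleStat_zeroSum {n : ℕ} (hn : n ≠ 0) {U : (Fin n → ℝ) → ℝ} {p : ℝ}
    (hU : IsFeasibleDefinite U p) : Continuous fun y : zeroSum n => feasibleStat U y :=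
  (continuous_feasibleStat hn hU).comp continuous_subtype_val

/-- By homogeneity and compactness of the unit sphere, the statistic dominates the norm. -/
lemma exists_mul_norm_le_feasibleStat {n : ℕ} (hn : 2 ≤ n) {U : (Fin n → ℝ) → ℝ}
    (hU : IsFeasibleDefinite U 1) : ∃ m > 0, ∀ y : zeroSum n, m * ‖y‖ ≤ feasibleStat U y := by
  have hn0 : n ≠ 0 := by omega
  have := nontrivial_zeroSum hn
  obtain ⟨z, hz, hmin⟩ := (isCompact_sphere (0 : zeroSum n) 1).exists_isMinOn
    (NormedSpace.sphere_nonempty.mpr zero_le_one)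
    (continuous_feasibleStat_zeroSum hn0 hU).continuousOn
  have hz1 : ‖z‖ = 1 := by simpa using hz
  refine ⟨feasibleStat U z, lt_of_le_of_ne (feasibleStat_nonneg hn0 hU _) fun h => ?_, fun y => ?_⟩
  · have : z = 0 := Subtype.ext (eq_zero_of_feasibleStat_eq_zero hn0 hU (sum_zeroSum z) h.symm)
    simp [this] at hz1
  · rcases eq_or_ne y 0 with rfl | hy
    · simpa using feasibleStat_nonneg hn0 hU _
    have hpos : 0 < ‖y‖ := norm_pos_iff.mpr hy
    have h1 : feasibleStat U z ≤ feasibleStat U (‖y‖⁻¹ • y : zeroSum n) :=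
      hmin (mem_sphere_zero_iff_norm.mpr
        (by rw [norm_smul, norm_inv, norm_norm, inv_mul_cancel₀ hpos.ne']))
    have h2 : feasibleStat U (‖y‖⁻¹ • y : zeroSum n) = ‖y‖⁻¹ * feasibleStat U y :=
      feasibleStat_smul hn0 hU (inv_pos.mpr hpos) _
    rw [h2, inv_mul_eq_div, le_div_iff₀ hpos] at h1
    exact h1

lemma isCompact_sublevel {n : ℕ} (hn : 2 ≤ n) {U : (Fin n → ℝ) → ℝ}
    (hU : IsFeasibleDefinite U 1) (ε : ℝ) : IsCompact (sublevel U ε) := by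
  obtain ⟨m, hm, h⟩ := exists_mul_norm_le_feasibleStat hn hU
  refine (isCompact_closedBall (0 : zeroSum n) (ε / m)).of_isClosed_subset
    (isClosed_le (continuous_feasibleStat_zeroSum (by omega) hU) continuous_const) fun y hy => ?_
  rw [mem_closedBall_zero_iff, le_div_iff₀' hm]
  exact (h y).trans hy

lemma eventually_forall_mem_sublevel {n : ℕ} (hn : 2 ≤ n) {U : (Fin n → ℝ) → ℝ}
    (hU : IsFeasibleDefinite U 1) {P : zeroSum n → Prop} (hP : ∀ᶠ y in 𝓝 0, P y) :
    ∀ᶠ ε in 𝓝[>] (0 : ℝ), ∀ y ∈ sublevel U ε, P y := by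
  obtain ⟨m, hm, h⟩ := exists_mul_norm_le_feasibleStat hn hU
  obtain ⟨δ, hδ, hball⟩ := Metric.eventually_nhds_iff_ball.mp hP
  filter_upwards [Ioo_mem_nhdsGT (mul_pos hm hδ)] with ε hε y hy
  refine hball y (mem_ball_zero_iff.mpr (lt_of_mul_lt_mul_left ?_ hm.le))
  exact ((h y).trans hy).trans_lt hε.2

lemma zeroSum_eventually_forall_mem {n : ℕ} {S : Set ℝ} (hS : S ∈ 𝓝 (0 : ℝ)) :
    ∀ᶠ y : zeroSum n in 𝓝 0, ∀ i, (y : Fin n → ℝ) i ∈ S := by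
  refine eventually_all.mpr fun i => ?_
  have : ContinuousAt (fun y : zeroSum n => (y : Fin n → ℝ) i) 0 :=
    ((continuous_apply i).comp continuous_subtype_val).continuousAt
  exact this (by simpa using hS)

lemma isOpen_feasibleStat_lt {n : ℕ} (hn : n ≠ 0) {U : (Fin n → ℝ) → ℝ} {p : ℝ}
    (hU : IsFeasibleDefinite U p) (ε : ℝ) : IsOpen {y : zeroSum n | feasibleStat U y < ε} :=
  isOpen_lt (continuous_feasibleStat_zeroSum hn hU) continuous_const

lemma measure_sublevel_diff_pos {n : ℕ} (hn : 2 ≤ n) {U : (Fin n → ℝ) → ℝ}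
    (hU : IsFeasibleDefinite U 1) (q : Measure (zeroSum n)) [q.IsAddHaarMeasure] {ε : ℝ}
    (hε : 0 < ε) : 0 < q (sublevel U ε \ {0}) := by
  have hn0 : n ≠ 0 := by omega
  have := nontrivial_zeroSum hn
  have hopen : IsOpen ({y : zeroSum n | feasibleStat U y < ε} \ {0}) :=
    (isOpen_feasibleStat_lt hn0 hU ε).sdiff isClosed_singleton
  refine (hopen.measure_pos q ?_).trans_le
    (measure_mono (Set.sdiff_subset_sdiff_left fun y (hy : _ < ε) => hy.le))
  obtain ⟨y, hy⟩ := exists_ne (0 : zeroSum n)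
  have hW := feasibleStat_nonneg hn0 hU (y : Fin n → ℝ)
  let t := ε / (feasibleStat U y + 1)
  have ht : 0 < t := by positivity
  refine ⟨t • y, ?_, by simp [hy, ht.ne']⟩
  have h2 : feasibleStat U (t • y : zeroSum n) = t * feasibleStat U y :=
    feasibleStat_smul hn0 hU ht _
  change feasibleStat U (t • y : zeroSum n) < ε
  rw [h2, div_mul_eq_mul_div, div_lt_iff₀ (by positivity)]
  nlinarith

lemma measure_sublevel_pos {n : ℕ} (hn : 2 ≤ n) {U : (Fin n → ℝ) → ℝ}
    (hU : IsFeasibleDefinite U 1) (q : Measure (zeroSum n)) [q.IsAddHaarMeasure] {ε : ℝ}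
    (hε : 0 < ε) : 0 < q (sublevel U ε) :=
  (measure_sublevel_diff_pos hn hU q hε).trans_le (measure_mono Set.sdiff_subset)

/-! ### Integrals of the joint density over caps -/

/-- The integral of the joint density `∏ f (s (1 + yᵢ))` over the cap where the statistic is at most
`ε`. Up to the factor `s ^ (n - 1)`, this is the density at `s` of the sample mean on the event
that the scale-invariant statistic is at most `ε`. -/
noncomputable def capIntegral {n : ℕ} (U : (Fin n → ℝ) → ℝ) (q : Measure (zeroSum n)) (f : ℝ → ℝ)
    (ε s : ℝ) : ℝ :=
  ∫ y in sublevel U ε, ∏ i, f (s * (1 + (y : Fin n → ℝ) i)) ∂q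

lemma continuousOn_prod_zeroSum {n : ℕ} {f : ℝ → ℝ} (hf : ContinuousOn f (Set.Ioi 0)) {s : ℝ}
    (hs : 0 < s) {D : Set (zeroSum n)} (hD : ∀ y ∈ D, ∀ i, (-1 / 2 : ℝ) < (y : Fin n → ℝ) i) :
    ContinuousOn (fun y : zeroSum n => ∏ i, f (s * (1 + (y : Fin n → ℝ) i))) D := by
  refine continuousOn_finsetProd _ fun i _ => hf.comp (Continuous.continuousOn ?_) fun y hy => ?_
  · exact continuous_const.mul
      (continuous_const.add ((continuous_apply i).comp continuous_subtype_val))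
  · exact mul_pos hs (by linarith [hD y hy i])

lemma continuousOn_capIntegral {n : ℕ} (hn : 2 ≤ n) {U : (Fin n → ℝ) → ℝ}
    (hU : IsFeasibleDefinite U 1) (q : Measure (zeroSum n)) [q.IsAddHaarMeasure] {f : ℝ → ℝ}
    (hf : ContinuousOn f (Set.Ioi 0)) {ε : ℝ}
    (hD : ∀ y ∈ sublevel U ε, ∀ i, (-1 / 2 : ℝ) < (y : Fin n → ℝ) i) :
    ContinuousOn (capIntegral U q f ε) (Set.Ioi 0) := by
  -- truncating `1 + yᵢ` at `1 / 2` and parametrizing `s = exp t` makes the integrand continuous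
  -- everywhere, without changing it on the cap
  let G : ℝ → zeroSum n → ℝ := fun t y =>
    ∏ i, f (Real.exp t * max (1 + (y : Fin n → ℝ) i) (1 / 2))
  have hG : Continuous G.uncurry := by
    refine continuous_finsetProd _ fun i _ => hf.comp_continuous ?_ fun p => ?_
    · have : Continuous fun p : ℝ × zeroSum n => (p.2 : Fin n → ℝ) i :=
        (continuous_apply i).comp (continuous_subtype_val.comp continuous_snd)
      fun_prop
    · exact mul_pos (Real.exp_pos _) (lt_max_of_lt_right (by norm_num))
  have hc := continuous_parametric_integral_of_continuous (μ := q) hG (isCompact_sublevel hn hU ε)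
  refine (hc.comp_continuousOn
    (Real.continuousOn_log.mono fun s (hs : 0 < s) => hs.ne')).congr fun s hs => ?_
  refine setIntegral_congr_fun (isCompact_sublevel hn hU ε).measurableSet fun y hy => ?_
  simp only [G, Real.exp_log hs]
  refine Finset.prod_congr rfl fun i _ => ?_
  rw [max_eq_left (by linarith [hD y hy i])]

lemma capIntegral_pos {n : ℕ} (hn : 2 ≤ n) {U : (Fin n → ℝ) → ℝ}
    (hU : IsFeasibleDefinite U 1) (q : Measure (zeroSum n)) [q.IsAddHaarMeasure] {f : ℝ → ℝ}
    (hf : ContinuousOn f (Set.Ioi 0)) (hf_pos : ∀ x, 0 < x → 0 < f x) {ε : ℝ} (hε : 0 < ε)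
    (hD : ∀ y ∈ sublevel U ε, ∀ i, (-1 / 2 : ℝ) < (y : Fin n → ℝ) i) {s : ℝ} (hs : 0 < s) :
    0 < capIntegral U q f ε s := by
  have hcpt := isCompact_sublevel hn hU ε
  have hpos : ∀ y ∈ sublevel U ε, 0 < ∏ i, f (s * (1 + (y : Fin n → ℝ) i)) := fun y hy =>
    Finset.prod_pos fun i _ => hf_pos _ (mul_pos hs (by linarith [hD y hy i]))
  rw [capIntegral, setIntegral_pos_iff_support_of_nonneg_ae
    ((ae_restrict_iff' hcpt.measurableSet).mpr (Eventually.of_forall fun y hy => (hpos y hy).le))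
    ((continuousOn_prod_zeroSum hf hs hD).integrableOn_compact hcpt)]
  exact (measure_sublevel_pos hn hU q hε).trans_le
    (measure_mono fun y hy => ⟨(hpos y hy).ne', hy⟩)

/-- On small caps the joint density is nearly constant. -/
lemma tendsto_capIntegral_div {n : ℕ} (hn : 2 ≤ n) {U : (Fin n → ℝ) → ℝ}
    (hU : IsFeasibleDefinite U 1) (q : Measure (zeroSum n)) [q.IsAddHaarMeasure] {f : ℝ → ℝ}
    (hf : ContinuousOn f (Set.Ioi 0)) {s : ℝ} (hs : 0 < s) :
    Tendsto (fun ε => capIntegral U q f ε s / q.real (sublevel U ε)) (𝓝[>] 0) (𝓝 (f s ^ n)) := by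
  have hcont : ContinuousAt
      (fun y : zeroSum n => ∏ i, f (s * (1 + (y : Fin n → ℝ) i))) 0 := by
    have hD : ∀ᶠ y : zeroSum n in 𝓝 0, ∀ i, (y : Fin n → ℝ) i ∈ Set.Ioi (-1 / 2 : ℝ) :=
      zeroSum_eventually_forall_mem (Ioi_mem_nhds (by norm_num))
    exact (continuousOn_prod_zeroSum hf hs 
      (D := {y : zeroSum n | ∀ i, (y : Fin n → ℝ) i ∈ Set.Ioi (-1 / 2 : ℝ)})
      fun y hy => hy).continuousAt hD
  rw [Metric.tendsto_nhds]
  intro η hη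
  have hclose : ∀ᶠ y : zeroSum n in 𝓝 0,
      ‖(∏ i, f (s * (1 + (y : Fin n → ℝ) i))) - f s ^ n‖ ≤ η / 2 := by
    have h := Metric.tendsto_nhds.mp hcont.tendsto (η / 2) (half_pos hη)
    filter_upwards [h] with y hy
    have : f s ^ n = ∏ i, f (s * (1 + ((0 : zeroSum n) : Fin n → ℝ) i)) := by simp
    rw [this, ← dist_eq_norm]
    exact hy.le
  have hD : ∀ᶠ y : zeroSum n in 𝓝 0, ∀ i, (y : Fin n → ℝ) i ∈ Set.Ioi (-1 / 2 : ℝ) :=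
    zeroSum_eventually_forall_mem (Ioi_mem_nhds (by norm_num))
  filter_upwards [eventually_forall_mem_sublevel hn hU hclose,
    eventually_forall_mem_sublevel hn hU hD, self_mem_nhdsWithin] with ε h1 h2 hε
  have hcpt := isCompact_sublevel hn hU ε
  have hq : 0 < q.real (sublevel U ε) :=
    ENNReal.toReal_pos (measure_sublevel_pos hn hU q hε).ne' hcpt.measure_lt_top.ne
  have hint := (continuousOn_prod_zeroSum hf hs h2).integrableOn_compact (μ := q) hcpt
  have hbound := norm_setIntegral_le_of_norm_le_const (μ := q) hcpt.measure_lt_top h1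
  rw [integral_sub hint (integrableOn_const hcpt.measure_lt_top.ne), setIntegral_const,
    smul_eq_mul] at hbound
  rw [Real.dist_eq, div_sub' hq.ne', abs_div, abs_of_pos hq, div_lt_iff₀ hq]
  calc _ ≤ η / 2 * q.real (sublevel U ε) := hbound
    _ < η * q.real (sublevel U ε) := by gcongr; linarith

/-- Independence forces the integrals of the joint density over small caps at different means to be
proportional to each other, in the ratio of the joint densities at the cap centres. -/
lemma eventually_capIntegral_mul_eq {n : ℕ} (hn : 2 ≤ n) {U : (Fin n → ℝ) → ℝ}
    (hU : IsFeasibleDefinite U 1) {F : Measure ℝ} [IsProbabilityMeasure F] {f : ℝ → ℝ}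
    (hf : ContinuousOn f (Set.Ioi 0)) (hf_pos : ∀ x, 0 < x → 0 < f x)
    (hF : F = (volume.restrict (Set.Ioi 0)).withDensity (fun x => ENNReal.ofReal (f x)))
    (hind : IndepFun sampleMean (fun x : Fin n → ℝ => feasibleStat U x / sampleMean x)
      (Measure.pi fun _ => F)) :
    ∃ q : Measure (zeroSum n), q.IsAddHaarMeasure ∧ ∀ᶠ ε in 𝓝[>] 0, ∀ x₀ > 0, ∀ x₁ > 0,
      capIntegral U q f ε x₀ * f x₁ ^ n = capIntegral U q f ε x₁ * f x₀ ^ n := by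
  have hn0 : n ≠ 0 := by omega
  obtain ⟨q, hq, hpi⟩ := exists_haar_pi_apply hn0 hU
  refine ⟨q, hq, ?_⟩
  let g : ℝ → ℝ := (Set.Ioi 0).indicator f
  have hgm : Measurable g := by
    classical
    have h : Measurable ((Set.Ioi 0).piecewise f 0) :=
      hf.measurable_piecewise (g := fun _ => 0) continuousOn_const measurableSet_Ioi
    rwa [Set.piecewise_eq_indicator] at h
  have hgf : ∀ x, 0 < x → g x = f x := fun x hx => Set.indicator_of_mem (by exact hx) _
  have hg0 : 0 ≤ g := Set.indicator_nonneg fun x hx => (hf_pos x hx).le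
  have hgneg : ∀ x ≤ 0, g x = 0 := fun x hx => Set.indicator_of_notMem (by simpa using hx) _
  have hFg : F = volume.withDensity fun x => ENNReal.ofReal (g x) := by
    rw [hF, ← withDensity_indicator measurableSet_Ioi]
    congr 1
    ext x
    by_cases hx : 0 < x
    · rw [hgf x hx, Set.indicator_of_mem (by exact hx)]
    · rw [hgneg x (not_lt.mp hx), Set.indicator_of_notMem (by exact hx), ENNReal.ofReal_zero]
  have hD : ∀ᶠ y : zeroSum n in 𝓝 0, ∀ i, (y : Fin n → ℝ) i ∈ Set.Ioi (-1 / 2 : ℝ) :=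
    zeroSum_eventually_forall_mem (Ioi_mem_nhds (by norm_num))
  let P : ℝ → ℝ≥0∞ := fun ε => Measure.pi (fun _ : Fin n => F)
    ((fun x => feasibleStat U x / sampleMean x) ⁻¹' Set.Iic ε)
  let good : ℝ → Prop := fun ε => 0 < ε ∧
    ∀ y ∈ sublevel U ε, ∀ i, (-1 / 2 : ℝ) < (y : Fin n → ℝ) i
  have hgood : ∀ᶠ ε in 𝓝[>] (0 : ℝ), good ε := by
    filter_upwards [eventually_forall_mem_sublevel hn hU hD, self_mem_nhdsWithin] with ε h1 h2
    exact ⟨h2, h1⟩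
  have hdens_cont : ∀ ε, good ε →
      ContinuousOn (fun s => s ^ (n - 1) * capIntegral U q f ε s) (Set.Ioi 0) := fun ε hε =>
    (by fun_prop : ContinuousOn (fun s : ℝ => s ^ (n - 1)) (Set.Ioi 0)).mul
      (continuousOn_capIntegral hn hU q hf hε.2)
  have hdens_pos : ∀ ε, good ε → ∀ s, 0 < s → 0 < s ^ (n - 1) * capIntegral U q f ε s :=
    fun ε hε s hs => mul_pos (pow_pos hs _) (capIntegral_pos hn hU q hf hf_pos hε.1 hε.2 hs)
  have hdens_meas : ∀ ε, good ε → AEMeasurable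
      (fun s => ENNReal.ofReal (s ^ (n - 1) * capIntegral U q f ε s))
      (volume.restrict (Set.Ioi 0)) := fun ε hε =>
    ((hdens_cont ε hε).aemeasurable measurableSet_Ioi).ennreal_ofReal
  have hjoint : ∀ ε, good ε → ∀ C, MeasurableSet C →
      Measure.pi (fun _ : Fin n => F) (sampleMean ⁻¹' C ∩
        (fun x => feasibleStat U x / sampleMean x) ⁻¹' Set.Iic ε) =
      ∫⁻ s in C, ENNReal.ofReal (s ^ (n - 1) * capIntegral U q f ε s)
        ∂(volume.restrict (Set.Ioi 0)) := by
    intro ε hε C hC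
    rw [hpi F g inferInstance hgm hg0 hgneg hFg C _ hC measurableSet_Iic]
    refine lintegral_congr_ae (ae_restrict_of_ae ?_)
    filter_upwards [ae_restrict_mem measurableSet_Ioi] with s hs
    have hs : 0 < s := hs
    have hcpt := isCompact_sublevel hn hU ε
    rw [ENNReal.ofReal_mul (pow_pos hs _).le]
    congr 1
    rw [capIntegral, ofReal_integral_eq_lintegral_ofReal
      ((continuousOn_prod_zeroSum hf hs hε.2).integrableOn_compact hcpt)]
    · refine setLIntegral_congr_fun hcpt.measurableSet fun y hy => ?_
      congr 1
      exact Finset.prod_congr rfl fun i _ => hgf _ (mul_pos hs (by linarith [hε.2 y hy i]))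
    · exact (ae_restrict_iff' hcpt.measurableSet).mpr (Eventually.of_forall fun y hy =>
        Finset.prod_nonneg fun i _ => (hf_pos _ (mul_pos hs (by linarith [hε.2 y hy i]))).le)
  have hP_top : ∀ ε, P ε ≠ ∞ := fun ε => measure_ne_top _ _
  have hP_pos : ∀ ε, good ε → P ε ≠ 0 := by
    intro ε hε h0
    have h := hjoint ε hε Set.univ MeasurableSet.univ
    rw [Set.preimage_univ, Set.univ_inter, Measure.restrict_univ] at h
    rw [show P ε = _ from h, lintegral_eq_zero_iff' (hdens_meas ε hε)] at h0
    have h1 : ∀ᵐ s ∂(volume.restrict (Set.Ioi (0 : ℝ))), False := by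
      filter_upwards [h0, ae_restrict_mem measurableSet_Ioi] with s h1 h2
      exact (ENNReal.ofReal_pos.mpr (hdens_pos ε hε s h2)).ne' h1
    rw [ae_restrict_iff' measurableSet_Ioi] at h1
    have h2 : volume (Set.Ioi (0 : ℝ)) = 0 := by
      have h := ae_iff.mp h1
      simp only [imp_false, not_not] at h
      exact h
    simp at h2
  have hindep : ∀ ε C, MeasurableSet C → Measure.pi (fun _ : Fin n => F) (sampleMean ⁻¹' C ∩
        (fun x => feasibleStat U x / sampleMean x) ⁻¹' Set.Iic ε) =
      Measure.pi (fun _ : Fin n => F) (sampleMean ⁻¹' C) * P ε := fun ε C hC =>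
    hind.measure_inter_preimage_eq_mul C _ hC measurableSet_Iic
  have hcross : ∀ ε δ, good ε → good δ → ∀ s, 0 < s →
      capIntegral U q f ε s * (P δ).toReal = capIntegral U q f δ s * (P ε).toReal := by
    intro ε δ hε hδ s hs
    have hae : (fun s => ENNReal.ofReal (s ^ (n - 1) * capIntegral U q f ε s) * P δ)
        =ᵐ[volume.restrict (Set.Ioi 0)]
        fun s => ENNReal.ofReal (s ^ (n - 1) * capIntegral U q f δ s) * P ε := by
      refine ae_eq_of_forall_setLIntegral_eq_of_sigmaFinite₀ ((hdens_meas ε hε).mul_const _)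
        ((hdens_meas δ hδ).mul_const _) fun C hC _ => ?_
      rw [lintegral_mul_const' _ _ (hP_top δ), lintegral_mul_const' _ _ (hP_top ε),
        ← hjoint ε hε C hC, ← hjoint δ hδ C hC, hindep ε C hC, hindep δ C hC]
      ring
    have hae' : (fun s => s ^ (n - 1) * capIntegral U q f ε s * (P δ).toReal)
        =ᵐ[volume.restrict (Set.Ioi 0)]
        fun s => s ^ (n - 1) * capIntegral U q f δ s * (P ε).toReal := by
      filter_upwards [hae, ae_restrict_mem measurableSet_Ioi] with s h1 h2
      have := congrArg ENNReal.toReal h1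
      rwa [ENNReal.toReal_mul, ENNReal.toReal_mul, ENNReal.toReal_ofReal (hdens_pos ε hε s h2).le,
        ENNReal.toReal_ofReal (hdens_pos δ hδ s h2).le] at this
    have h := Measure.eqOn_open_of_ae_eq hae' isOpen_Ioi
      ((hdens_cont ε hε).mul continuousOn_const) ((hdens_cont δ hδ).mul continuousOn_const) hs
    dsimp only at h
    rw [mul_assoc, mul_assoc] at h
    exact mul_left_cancel₀ (pow_pos hs _).ne' h
  filter_upwards [hgood] with ε hε x₀ hx₀ x₁ hx₁
  have hratio : ∀ᶠ δ in 𝓝[>] (0 : ℝ),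
      capIntegral U q f ε x₀ * (capIntegral U q f δ x₁ / q.real (sublevel U δ)) =
      capIntegral U q f ε x₁ * (capIntegral U q f δ x₀ / q.real (sublevel U δ)) := by
    filter_upwards [hgood] with δ hδ
    have h0 := hcross ε δ hε hδ x₀ hx₀
    have h1 := hcross ε δ hε hδ x₁ hx₁
    have hPε := ENNReal.toReal_ne_zero.mpr ⟨hP_pos ε hε, hP_top ε⟩
    have h : capIntegral U q f ε x₀ * capIntegral U q f δ x₁ =
        capIntegral U q f ε x₁ * capIntegral U q f δ x₀ := by
      refine mul_right_cancel₀ hPε ?_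
      linear_combination -capIntegral U q f ε x₀ * h1 + capIntegral U q f ε x₁ * h0
    rw [← mul_div_assoc, ← mul_div_assoc, h]
  exact tendsto_nhds_unique_of_eventuallyEq
    ((tendsto_capIntegral_div hn hU q hf hx₁).const_mul _)
    ((tendsto_capIntegral_div hn hU q hf hx₀).const_mul _) hratio

/-! ### Comparison with gamma densities -/

/-- The second difference of `h` over the triple `p`, `m`, `r`, scaled to have no denominators. It
vanishes on affine functions and, for `p < m < r`, is nonnegative on convex ones. -/
def secondDiff (h : ℝ → ℝ) (p m r : ℝ) : ℝ :=
  (r - m) * h p + (m - p) * h r - (r - p) * h m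

lemma secondDiff_add_const_mul (h k : ℝ → ℝ) (c p m r : ℝ) :
    secondDiff (fun x => h x + c * k x) p m r = secondDiff h p m r + c * secondDiff k p m r := by
  simp only [secondDiff]
  ring

lemma secondDiff_log_neg {p m r : ℝ} (hp : 0 < p) (hpm : p < m) (hmr : m < r) :
    secondDiff Real.log p m r < 0 := by
  have h := strictConcaveOn_log_Ioi.slope_anti_adjacent hp
    (show (0 : ℝ) < r by linarith) hpm hmr
  rw [div_lt_div_iff₀ (by linarith) (by linarith)] at h
  simp only [secondDiff]
  linarith

/-- If `h` lies above its chord at some point, then a suitable affine function touches it from above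
at an interior point. -/
lemma exists_le_affine_of_secondDiff_neg {h : ℝ → ℝ} {p m r : ℝ} (hpm : p < m) (hmr : m < r)
    (hh : ContinuousOn h (Set.Icc p r)) (hneg : secondDiff h p m r < 0) :
    ∃ x₀ ∈ Set.Ioo p r, ∃ α, ∀ x ∈ Set.Icc p r, h x ≤ h x₀ + α * (x - x₀) := by
  have hpr : 0 < r - p := by linarith
  let α := (h r - h p) / (r - p)
  have hα : α * (r - p) = h r - h p := div_mul_cancel₀ _ hpr.ne'
  obtain ⟨x₀, hx₀, hmax⟩ := isCompact_Icc.exists_isMaxOn (Set.nonempty_Icc.mpr (hpm.trans hmr).le)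
    (hh.sub (by fun_prop : ContinuousOn (fun x => α * (x - p)) (Set.Icc p r)))
  have hmax : ∀ x ∈ Set.Icc p r, h x - α * (x - p) ≤ h x₀ - α * (x₀ - p) := hmax
  have hm : h p < h m - α * (m - p) := by
    refine lt_of_mul_lt_mul_left ?_ hpr.le
    have : (r - p) * (h m - α * (m - p)) = (r - p) * h m - (h r - h p) * (m - p) := by
      rw [← hα]
      ring
    rw [this]
    simp only [secondDiff] at hneg
    linarith
  have hm' := hmax m ⟨hpm.le, hmr.le⟩
  refine ⟨x₀, ⟨lt_of_le_of_ne hx₀.1 ?_, lt_of_le_of_ne hx₀.2 ?_⟩, α, fun x hx => ?_⟩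
  · rintro rfl
    linarith
  · rintro rfl
    linarith
  · linarith [hmax x hx]

lemma sum_log_one_add_neg {n : ℕ} {y : zeroSum n} (hy : ∀ i, -1 < (y : Fin n → ℝ) i)
    (hy0 : y ≠ 0) : ∑ i, Real.log (1 + (y : Fin n → ℝ) i) < 0 := by
  obtain ⟨i, hi⟩ : ∃ i, (y : Fin n → ℝ) i ≠ 0 := by
    by_contra! h
    exact hy0 (Subtype.ext (funext h))
  have hle : ∀ j, Real.log (1 + (y : Fin n → ℝ) j) ≤ (y : Fin n → ℝ) j := fun j => by
    linarith [Real.log_le_sub_one_of_pos (show 0 < 1 + (y : Fin n → ℝ) j by linarith [hy j])]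
  have hlt : Real.log (1 + (y : Fin n → ℝ) i) < (y : Fin n → ℝ) i := by
    have := Real.log_lt_sub_one_of_pos (show 0 < 1 + (y : Fin n → ℝ) i by linarith [hy i])
      (fun h => hi (by linarith))
    linarith
  exact (Finset.sum_lt_sum (fun j _ => hle j) ⟨i, Finset.mem_univ i, hlt⟩).trans_eq (sum_zeroSum y)

/-- The affine correction contributes nothing to a product over coordinates with sum zero. -/
lemma sum_log_le_of_le_affine {n : ℕ} {f : ℝ → ℝ} {c α p r x₀ : ℝ} (hx₀ : 0 < x₀)
    (h : ∀ x ∈ Set.Icc p r,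
      Real.log (f x) + c * Real.log x ≤ Real.log (f x₀) + c * Real.log x₀ + α * (x - x₀))
    {y : zeroSum n} (hy : ∀ i, -1 < (y : Fin n → ℝ) i)
    (hmem : ∀ i, x₀ * (1 + (y : Fin n → ℝ) i) ∈ Set.Icc p r) :
    ∑ i, Real.log (f (x₀ * (1 + (y : Fin n → ℝ) i))) ≤
      n * Real.log (f x₀) - c * ∑ i, Real.log (1 + (y : Fin n → ℝ) i) := by
  have hterm : ∀ i, Real.log (f (x₀ * (1 + (y : Fin n → ℝ) i))) ≤
      Real.log (f x₀) - c * Real.log (1 + (y : Fin n → ℝ) i) + α * x₀ * (y : Fin n → ℝ) i :=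
    fun i => by
      have h1 := h _ (hmem i)
      have h2 : 0 < 1 + (y : Fin n → ℝ) i := by linarith [hy i]
      rw [Real.log_mul hx₀.ne' h2.ne'] at h1
      linarith
  refine (Finset.sum_le_sum fun i _ => hterm i).trans_eq ?_
  rw [Finset.sum_add_distrib, Finset.sum_sub_distrib, ← Finset.mul_sum, ← Finset.mul_sum,
    sum_zeroSum y]
  simp

/-- The same bound from below, at a point where an affine function touches from below. -/
lemma le_sum_log_of_affine_le {n : ℕ} {f : ℝ → ℝ} {c α p r x₀ : ℝ} (hx₀ : 0 < x₀)
    (h : ∀ x ∈ Set.Icc p r,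
      Real.log (f x₀) + c * Real.log x₀ + α * (x - x₀) ≤ Real.log (f x) + c * Real.log x)
    {y : zeroSum n} (hy : ∀ i, -1 < (y : Fin n → ℝ) i)
    (hmem : ∀ i, x₀ * (1 + (y : Fin n → ℝ) i) ∈ Set.Icc p r) :
    n * Real.log (f x₀) - c * ∑ i, Real.log (1 + (y : Fin n → ℝ) i) ≤
      ∑ i, Real.log (f (x₀ * (1 + (y : Fin n → ℝ) i))) := by
  have h' := sum_log_le_of_le_affine (f := fun x => (f x)⁻¹) (c := -c) (α := -α) hx₀
    (fun x hx => by
      simp only [Real.log_inv]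
      linarith [h x hx]) hy hmem
  simp only [Real.log_inv, Finset.sum_neg_distrib] at h'
  linarith

lemma eventually_mem_Icc_mul {n : ℕ} {p r x₀ : ℝ} (hx₀ : x₀ ∈ Set.Ioo p r) :
    ∀ᶠ y : zeroSum n in 𝓝 0, ∀ i, x₀ * (1 + (y : Fin n → ℝ) i) ∈ Set.Icc p r := by
  have hcont : ContinuousAt (fun t : ℝ => x₀ * (1 + t)) 0 := by fun_prop
  have hmem : Set.Icc p r ∈ 𝓝 (x₀ * (1 + 0)) := by
    rw [add_zero, mul_one]
    exact Icc_mem_nhds hx₀.1 hx₀.2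
  exact zeroSum_eventually_forall_mem (hcont hmem)

lemma prod_eq_exp_sum_log {n : ℕ} {f : ℝ → ℝ} (hf_pos : ∀ x, 0 < x → 0 < f x) {s : ℝ}
    (hs : 0 < s) {y : zeroSum n} (hy : ∀ i, -1 < (y : Fin n → ℝ) i) :
    ∏ i, f (s * (1 + (y : Fin n → ℝ) i)) =
      Real.exp (∑ i, Real.log (f (s * (1 + (y : Fin n → ℝ) i)))) := by
  rw [Real.exp_sum]
  exact Finset.prod_congr rfl fun i _ =>
    (Real.exp_log (hf_pos _ (mul_pos hs (by linarith [hy i])))).symm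

/-- Comparison with gamma densities: `log f + c log` cannot lie strictly above one of its chords
while `log f + c' log` lies strictly below one of its chords, for some `c' > c`. Otherwise the
integrals over small caps around the touching points would contradict their proportionality. -/
lemma not_secondDiff_neg_and_pos {n : ℕ} (hn : 2 ≤ n) {U : (Fin n → ℝ) → ℝ}
    (hU : IsFeasibleDefinite U 1) {q : Measure (zeroSum n)} [q.IsAddHaarMeasure] {f : ℝ → ℝ}
    (hf : ContinuousOn f (Set.Ioi 0)) (hf_pos : ∀ x, 0 < x → 0 < f x)
    (hcap : ∀ᶠ ε in 𝓝[>] 0, ∀ x₀ > 0, ∀ x₁ > 0,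
      capIntegral U q f ε x₀ * f x₁ ^ n = capIntegral U q f ε x₁ * f x₀ ^ n)
    {c c' p m r p' m' r' : ℝ} (hc : c < c') (hp : 0 < p) (hpm : p < m) (hmr : m < r)
    (hp' : 0 < p') (hpm' : p' < m') (hmr' : m' < r')
    (hneg : secondDiff (fun x => Real.log (f x) + c * Real.log x) p m r < 0) :
    secondDiff (fun x => Real.log (f x) + c' * Real.log x) p' m' r' ≤ 0 := by
  by_contra! hpos
  have hcont : ∀ c p r : ℝ, 0 < p →
      ContinuousOn (fun x => Real.log (f x) + c * Real.log x) (Set.Icc p r) := by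
    intro c p r hp
    have h0 : ∀ x ∈ Set.Icc p r, 0 < x := fun x hx => hp.trans_le hx.1
    exact ((hf.mono h0).log fun x hx => (hf_pos x (h0 x hx)).ne').add
      (continuousOn_const.mul (continuousOn_id.log fun x hx => (h0 x hx).ne'))
  obtain ⟨x₀, hx₀, α, hα⟩ := exists_le_affine_of_secondDiff_neg hpm hmr (hcont c p r hp) hneg
  obtain ⟨x₁, hx₁, β, hβ⟩ := exists_le_affine_of_secondDiff_neg hpm' hmr'
    (hcont c' p' r' hp').neg (by
      simp only [secondDiff, Pi.neg_apply] at hpos ⊢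
      linarith)
  have hx₀0 : 0 < x₀ := hp.trans hx₀.1
  have hx₁0 : 0 < x₁ := hp'.trans hx₁.1
  have hD : ∀ᶠ y : zeroSum n in 𝓝 0, ∀ i, (y : Fin n → ℝ) i ∈ Set.Ioi (-1 / 2 : ℝ) :=
    zeroSum_eventually_forall_mem (Ioi_mem_nhds (by norm_num))
  obtain ⟨ε, hcap, h0, h1, hD, hε⟩ := (hcap.and
    ((eventually_forall_mem_sublevel hn hU (eventually_mem_Icc_mul hx₀)).and
    ((eventually_forall_mem_sublevel hn hU (eventually_mem_Icc_mul hx₁)).and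
    ((eventually_forall_mem_sublevel hn hU hD).and
      (self_mem_nhdsWithin : Set.Ioi (0 : ℝ) ∈ 𝓝[>] 0))))).exists
  have hε : 0 < ε := hε
  have hcpt := isCompact_sublevel hn hU ε
  have hD1 : ∀ y ∈ sublevel U ε, ∀ i, -1 < (y : Fin n → ℝ) i := fun y hy i => by
    have : (-1 / 2 : ℝ) < (y : Fin n → ℝ) i := hD y hy i
    linarith
  let K : ℝ → zeroSum n → ℝ := fun c y =>
    Real.exp (-c * ∑ i, Real.log (1 + (y : Fin n → ℝ) i))
  have hKint : ∀ c, IntegrableOn (K c) (sublevel U ε) q := by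
    intro c
    refine ContinuousOn.integrableOn_compact hcpt
      (continuousOn_const.mul (continuousOn_finsetSum _ fun i _ => ?_)).rexp
    refine ContinuousOn.log (Continuous.continuousOn ?_) fun y hy => ?_
    · exact continuous_const.add ((continuous_apply i).comp continuous_subtype_val)
    · linarith [hD1 y hy i]
  have hpow : ∀ x, 0 < x → f x ^ n = Real.exp (n * Real.log (f x)) := fun x hx => by
    rw [Real.exp_nat_mul, Real.exp_log (hf_pos x hx)]
  have hupper : capIntegral U q f ε x₀ ≤ f x₀ ^ n * ∫ y in sublevel U ε, K c y ∂q := by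
    rw [← integral_const_mul]
    refine setIntegral_mono_on
      ((continuousOn_prod_zeroSum hf hx₀0 hD).integrableOn_compact hcpt)
      ((hKint c).const_mul _) hcpt.measurableSet fun y hy => ?_
    rw [prod_eq_exp_sum_log hf_pos hx₀0 (hD1 y hy), hpow x₀ hx₀0, ← Real.exp_add,
      Real.exp_le_exp]
    linarith [sum_log_le_of_le_affine hx₀0 hα (hD1 y hy) (h0 y hy)]
  have hlower : f x₁ ^ n * ∫ y in sublevel U ε, K c' y ∂q ≤ capIntegral U q f ε x₁ := by
    rw [← integral_const_mul]
    refine setIntegral_mono_on ((hKint c').const_mul _)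
      ((continuousOn_prod_zeroSum hf hx₁0 hD).integrableOn_compact hcpt)
      hcpt.measurableSet fun y hy => ?_
    rw [prod_eq_exp_sum_log hf_pos hx₁0 (hD1 y hy), hpow x₁ hx₁0, ← Real.exp_add,
      Real.exp_le_exp]
    have := le_sum_log_of_affine_le (f := f) (c := c') (α := -β) hx₁0 (fun x hx => by
      have := hβ x hx
      simp only [Pi.neg_apply] at this
      linarith) (hD1 y hy) (h1 y hy)
    linarith
  have hK : ∫ y in sublevel U ε, K c y ∂q < ∫ y in sublevel U ε, K c' y ∂q := by
    rw [← sub_pos, ← integral_sub' (hKint c') (hKint c)]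
    have hlt : ∀ y ∈ sublevel U ε, y ≠ 0 → 0 < K c' y - K c y := fun y hy hy0 => by
      rw [sub_pos, Real.exp_lt_exp]
      nlinarith [sum_log_one_add_neg (hD1 y hy) hy0]
    rw [setIntegral_pos_iff_support_of_nonneg_ae
      ((ae_restrict_iff' hcpt.measurableSet).mpr (Eventually.of_forall fun y hy => ?_))
      ((hKint c').sub (hKint c))]
    · exact (measure_sublevel_diff_pos hn hU q hε).trans_le
        (measure_mono fun y hy => ⟨(hlt y hy.1 hy.2).ne', hy.1⟩)
    · rcases eq_or_ne y 0 with rfl | hy0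
      · simp [K]
      · exact (hlt y hy hy0).le
  have hf₀ : 0 < f x₀ ^ n := pow_pos (hf_pos x₀ hx₀0) n
  have hf₁ : 0 < f x₁ ^ n := pow_pos (hf_pos x₁ hx₁0) n
  have := hcap x₀ hx₀0 x₁ hx₁0
  have h2 := mul_le_mul_of_nonneg_right hupper hf₁.le
  have h3 := mul_le_mul_of_nonneg_right hlower hf₀.le
  have h4 := mul_lt_mul_of_pos_left hK (mul_pos hf₀ hf₁)
  linarith

lemma exists_eq_affine_of_secondDiff_eq_zero {h : ℝ → ℝ}
    (hh : ∀ p m r, 0 < p → p < m → m < r → secondDiff h p m r = 0) :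
    ∃ α β, ∀ x, 0 < x → h x = α * x + β := by
  refine ⟨h 2 - h 1, 2 * h 1 - h 2, fun x hx => ?_⟩
  simp only [secondDiff] at hh
  rcases lt_trichotomy x 1 with h1 | rfl | h1
  · linarith [hh x 1 2 hx h1 (by norm_num)]
  · ring
  · rcases lt_trichotomy x 2 with h2 | rfl | h2
    · linarith [hh 1 x 2 one_pos h1 h2]
    · ring
    · linarith [hh 1 2 x one_pos (by norm_num) h2]

/-- The coefficient `c` is the one for which the second difference over `1, 2, 3` vanishes; the
comparison with nearby coefficients then makes every other second difference vanish. -/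
lemma exists_log_eq {n : ℕ} (hn : 2 ≤ n) {U : (Fin n → ℝ) → ℝ}
    (hU : IsFeasibleDefinite U 1) {q : Measure (zeroSum n)} [q.IsAddHaarMeasure] {f : ℝ → ℝ}
    (hf : ContinuousOn f (Set.Ioi 0)) (hf_pos : ∀ x, 0 < x → 0 < f x)
    (hcap : ∀ᶠ ε in 𝓝[>] 0, ∀ x₀ > 0, ∀ x₁ > 0,
      capIntegral U q f ε x₀ * f x₁ ^ n = capIntegral U q f ε x₁ * f x₀ ^ n) :
    ∃ c α β : ℝ, ∀ x, 0 < x → Real.log (f x) = α * x + β - c * Real.log x := by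
  let φ : ℝ → ℝ := fun x => Real.log (f x)
  have hL := secondDiff_log_neg (p := 1) (m := 2) (r := 3) one_pos (by norm_num) (by norm_num)
  let L := secondDiff Real.log 1 2 3
  obtain ⟨c₀, hc₀⟩ : ∃ c₀, secondDiff φ 1 2 3 = -c₀ * L :=
    ⟨-secondDiff φ 1 2 3 / L, by field_simp [show L ≠ 0 from hL.ne]⟩
  have hL : L < 0 := hL
  have hzero : ∀ p m r, 0 < p → p < m → m < r →
      secondDiff (fun x => φ x + c₀ * Real.log x) p m r = 0 := by
    intro p m r hp hpm hmr
    have hT := secondDiff_log_neg hp hpm hmr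
    rw [secondDiff_add_const_mul]
    set T := secondDiff Real.log p m r
    set S := secondDiff φ p m r
    by_contra hne
    have hhalf : (c₀ - (S + c₀ * T) / (2 * T)) * T = c₀ * T - (S + c₀ * T) / 2 := by
      field_simp [hT.ne]
    rcases lt_or_gt_of_ne hne with h | h
    · obtain ⟨c, hc1, hc2⟩ : ∃ c, S + c * T < 0 ∧ c < c₀ :=
        ⟨c₀ - (S + c₀ * T) / (2 * T), by
          rw [hhalf]
          linarith, by
          have := div_pos_of_neg_of_neg h (by linarith : 2 * T < 0)
          linarith⟩
      have := not_secondDiff_neg_and_pos hn hU hf hf_pos hcap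
        (show c < (c + c₀) / 2 by linarith) hp hpm hmr one_pos
        (show (1 : ℝ) < 2 by norm_num) (show (2 : ℝ) < 3 by norm_num)
        (by rw [secondDiff_add_const_mul]; exact hc1)
      rw [secondDiff_add_const_mul] at this
      have : secondDiff φ 1 2 3 + (c + c₀) / 2 * L ≤ 0 := this
      nlinarith
    · obtain ⟨c, hc1, hc2⟩ : ∃ c, 0 < S + c * T ∧ c₀ < c :=
        ⟨c₀ - (S + c₀ * T) / (2 * T), by
          rw [hhalf]
          linarith, by
          have := div_neg_of_pos_of_neg h (by linarith : 2 * T < 0)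
          linarith⟩
      have hneg : secondDiff φ 1 2 3 + (c + c₀) / 2 * L < 0 := by nlinarith
      have := not_secondDiff_neg_and_pos hn hU hf hf_pos hcap
        (show (c + c₀) / 2 < c by linarith) one_pos
        (show (1 : ℝ) < 2 by norm_num) (show (2 : ℝ) < 3 by norm_num) hp hpm hmr
        (by rw [secondDiff_add_const_mul]; exact hneg)
      rw [secondDiff_add_const_mul] at this
      exact hc1.not_ge this
  obtain ⟨α, β, h⟩ := exists_eq_affine_of_secondDiff_eq_zero hzero
  exact ⟨c₀, α, β, fun x hx => by linarith [h x hx]⟩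

/-! ### Identification of the gamma density -/

/-- A probability density on `(0, ∞)` of the form `exp β * x ^ (-c) * exp (α x)` is a gamma density:
integrability at `0` gives `c < 1`, integrability at infinity then gives `α < 0`, and the constant
is determined by the total mass. -/
lemma isGammaDistribution_of_log_eq {F : Measure ℝ} [IsProbabilityMeasure F] {f : ℝ → ℝ}
    (hf : ContinuousOn f (Set.Ioi 0)) (hf_pos : ∀ x, 0 < x → 0 < f x)
    (hF : F = (volume.restrict (Set.Ioi 0)).withDensity (fun x => ENNReal.ofReal (f x)))
    {c α β : ℝ} (hlog : ∀ x, 0 < x → Real.log (f x) = α * x + β - c * Real.log x) :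
    IsGammaDistribution F := by
  have hfx : ∀ x, 0 < x → f x = Real.exp β * (x ^ (-c) * Real.exp (α * x)) := fun x hx => by
    rw [← Real.exp_log (hf_pos x hx), hlog x hx, Real.rpow_def_of_pos hx, ← Real.exp_add,
      ← Real.exp_add]
    ring_nf
  have hint : IntegrableOn f (Set.Ioi 0) := by
    refine ⟨hf.aestronglyMeasurable measurableSet_Ioi, ?_⟩
    rw [hasFiniteIntegral_iff_ofReal
      ((ae_restrict_iff' measurableSet_Ioi).mpr (Eventually.of_forall fun x hx => (hf_pos x hx).le))]
    have h := measure_lt_top F Set.univ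
    rwa [hF, withDensity_apply _ MeasurableSet.univ, Measure.restrict_univ] at h
  have hint' : IntegrableOn (fun x : ℝ => x ^ (-c) * Real.exp (α * x)) (Set.Ioi 0) := by
    refine IntegrableOn.congr_fun (hint.const_mul (Real.exp β)⁻¹) (fun x hx => ?_)
      measurableSet_Ioi
    simp only [hfx x hx]
    rw [inv_mul_cancel_left₀ (Real.exp_pos β).ne']
  have hc : -1 < -c := by
    rw [← intervalIntegral.integrableOn_Ioo_rpow_iff (t := 1) one_pos]
    have h := (hint'.mono_set (Set.Ioo_subset_Ioi_self : Set.Ioo (0 : ℝ) 1 ⊆ _)).const_mul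
      (Real.exp |α|)
    refine Integrable.mono' h (by fun_prop) ?_
    refine (ae_restrict_iff' measurableSet_Ioo).mpr (Eventually.of_forall fun x hx => ?_)
    have hx0 : 0 < x := hx.1
    have h1 : 1 ≤ Real.exp |α| * Real.exp (α * x) := by
      rw [← Real.exp_add, Real.one_le_exp_iff]
      nlinarith [neg_abs_le α, hx.2, abs_nonneg α]
    rw [Real.norm_of_nonneg (by positivity)]
    have : 0 < x ^ (-c) := by positivity
    nlinarith
  have hα : α < 0 := by
    by_contra! hα
    have h := hint'.mono_set (Set.Ioi_subset_Ioi zero_le_one)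
    have : IntegrableOn (fun x : ℝ => x ^ (-c)) (Set.Ioi 1) := by
      refine Integrable.mono' h (by fun_prop) ?_
      refine (ae_restrict_iff' measurableSet_Ioi).mpr (Eventually.of_forall fun x hx => ?_)
      have hx0 : 0 < x := one_pos.trans hx
      rw [Real.norm_of_nonneg (by positivity)]
      exact le_mul_of_one_le_right (by positivity) (Real.one_le_exp (by positivity))
    rw [integrableOn_Ioi_rpow_iff one_pos] at this
    linarith
  have ha : 0 < 1 - c := by linarith
  have hr : 0 < -α := by linarith
  refine ⟨1 - c, (-α)⁻¹, ha, inv_pos.mpr hr, ?_⟩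
  rw [inv_inv]
  have hprob := isProbabilityMeasure_gammaMeasure ha hr
  -- `F` is a constant multiple of the gamma measure
  let C : ℝ := Real.exp β * (Real.Gamma (1 - c) / (-α) ^ (1 - c))
  have hG := Real.Gamma_pos_of_pos ha
  have hpw : 0 < (-α) ^ (1 - c) := by positivity
  have hmul : F = ENNReal.ofReal C • gammaMeasure (1 - c) (-α) := by
    rw [hF, gammaMeasure, ← withDensity_smul _ (by unfold gammaPDF; fun_prop),
      ← withDensity_indicator measurableSet_Ioi]
    refine withDensity_congr_ae ?_
    filter_upwards [compl_mem_ae_iff.mpr (measure_singleton (0 : ℝ))] with x hx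
    have hx : x ≠ 0 := hx
    rcases lt_or_gt_of_ne hx with h | h
    · rw [Set.indicator_of_notMem (by simpa using h.le), Pi.smul_apply, gammaPDF_of_neg h,
        smul_zero]
    · rw [Set.indicator_of_mem (by exact h), Pi.smul_apply, gammaPDF_of_nonneg h.le, smul_eq_mul,
        ← ENNReal.ofReal_mul (by positivity), hfx x h]
      congr 1
      simp only [C]
      rw [show 1 - c - 1 = -c by ring, show -(-α * x) = α * x by ring]
      field_simp
  have hone : ENNReal.ofReal C = 1 := by
    have h := congrArg (fun ν : Measure ℝ => ν Set.univ) hmul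
    simpa using h.symm
  rw [hmul, hone, one_smul]

/-! ### The characterization -/

lemma indepFun_comp_iff_indepFun_map {Ω E β γ : Type*} [MeasurableSpace Ω] [MeasurableSpace E]
    [MeasurableSpace β] [MeasurableSpace γ] {μ : Measure Ω} {X : Ω → E} (hX : AEMeasurable X μ)
    {g : E → β} {h : E → γ} (hg : Measurable g) (hh : Measurable h) :
    IndepFun (fun ω => g (X ω)) (fun ω => h (X ω)) μ ↔ IndepFun g h (μ.map X) := by
  simp only [indepFun_iff_measure_inter_preimage_eq_mul]
  refine forall₄_congr fun s t hs ht => ?_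
  rw [Measure.map_apply_of_aemeasurable hX ((hg hs).inter (hh ht)),
    Measure.map_apply_of_aemeasurable hX (hg hs), Measure.map_apply_of_aemeasurable hX (hh ht)]
  rfl

theorem theorem1 {Ω : Type*} [MeasurableSpace Ω] (μ : Measure Ω) [IsProbabilityMeasure μ]
    (n : ℕ) (hn : 3 ≤ n)
    (F : Measure ℝ) (f : ℝ → ℝ)
    (hf_cont : ContinuousOn f (Set.Ioi 0)) (hf_pos : ∀ x, 0 < x → 0 < f x)
    (hF : F = (volume.restrict (Set.Ioi 0)).withDensity (fun x => ENNReal.ofReal (f x)))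
    (X : Fin n → Ω → ℝ) (hX_indep : iIndepFun X μ) (hX_law : ∀ i, HasLaw (X i) F μ)
    (U : (Fin n → ℝ) → ℝ) (hU : IsFeasibleDefinite U 1) :
    IndepFun (fun ω => sampleMean (fun i => X i ω))
        (fun ω => feasibleStat U (fun i => X i ω) / sampleMean (fun i => X i ω)) μ ↔
      IsGammaDistribution F := by
  have hn0 : n ≠ 0 := by omega
  have hXm : ∀ i, AEMeasurable (X i) μ := fun i => (hX_law i).aemeasurable
  have hmap : μ.map (fun ω i => X i ω) = Measure.pi fun _ => F := by
    rw [(iIndepFun_iff_map_fun_eq_pi_map hXm).mp hX_indep]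
    congr 1
    ext1 i
    exact (hX_law i).map_eq
  have hFprob : IsProbabilityMeasure F := by
    rw [← (hX_law ⟨0, by omega⟩).map_eq]
    exact Measure.isProbabilityMeasure_map (hXm _)
  rw [indepFun_comp_iff_indepFun_map (X := fun ω i => X i ω) (g := sampleMean)
    (h := fun x => feasibleStat U x / sampleMean x) (aemeasurable_pi_lambda _ hXm)
    continuous_sampleMean.measurable
    ((continuous_feasibleStat hn0 hU).measurable.div continuous_sampleMean.measurable), hmap]
  constructor
  · intro hind
    obtain ⟨q, hq, hcap⟩ :=
      eventually_capIntegral_mul_eq (by omega) hU hf_cont hf_pos hF hind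
    obtain ⟨c, α, β, hlog⟩ := exists_log_eq (by omega) hU hf_cont hf_pos hcap
    exact isGammaDistribution_of_log_eq hf_cont hf_pos hF hlog
  · rintro ⟨a, b, ha, hb, rfl⟩
    exact indepFun_pi_gammaMeasure hn0 hU ha (inv_pos.mpr hb)
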